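/- **Theorem 1 (Equivalent Bellman Equation).** A source S sends packets to a destination D through a half-duplex relay R with a buffer of size $N_r$. Let $R_s,R_r\ge 1$ be integers (maximum rates of the S-R and R-D links), let $N_r>\max\{R_s,R_r\}$, and let $p_s,p_r\in[0,1]$ with $(p_s,p_r)\notin\{(0,0),(1,1)\}$. Write $\bar p_s=1-p_s$, $\bar p_r=1-p_r$, $\mathcal Q=\{0,1,\dots,N_r\}$ and $[x]^+=\max\{x,0\}$. In slot $t$ the system state is $X_t=(Q_t,G_t)\in\mathcal X=\mathcal Q\times\{0,1\}^2$, where $Q_t$ is the number of packets in the buffer and $G_t=(G_{s,t},G_{r,t})$ tells which links are connected; the $G_t$ are i.i.d. over time with independent components, $\Pr[G_{s,t}=1]=p_s$ and $\Pr[G_{r,t}=1]=p_r$. A stationary policy $\Omega=(\alpha,\mu)$ assigns to each state $X=(Q,G)$ a link selection $\alpha(X)=(a_s,a_r)\in\{0,1\}^2$ with $a_s+a_r\le 1$ and $(a_s,a_r)=G$ if $G\ne(1,1)$, and integer rates $\mu(X)=(u_s,u_r)$ with $0\le u_s\le\min\{R_s,N_r-Q\}$ and $0\le u_r\le\min\{R_r,Q\}$.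 The queue evolves as $Q_{t+1}=Q_t+a_su_s-a_ru_r$ and the reward of a slot is $a_ru_r$. The policy is unichain if the Markov chain $(X_t)$ that it induces on $\mathcal X$ has a single recurrent class. From the initial state $X_1$ its throughput is $\liminf_{T\to\infty}\frac1T\sum_{t=1}^T\mathbb E[a_{r,t}u_{r,t}]$. A policy is called optimal if it is unichain and, from every initial state, its throughput is maximal among all unichain policies. Then: (i) There is an optimal policy with the rate control $\mu^*(Q,G)=(\min\{R_s,N_r-Q\},\min\{R_r,Q\})$. (ii) There exist $\theta\in\mathbb R$ and $V:\mathcal Q\to\mathbb R$ such that for all $Q\in\mathcal Q$ $$\theta+V(Q)=\bar p_s\bar p_rV(Q)+p_s\bar p_rV(\min\{Q+R_s,N_r\})+\bar p_sp_r\big(\min\{Q,R_r\}+V([Q-R_r]^+)\big)+p_sp_r\max_{a_r\in\{0,1\}}L_V(Q,a_r),$$ where $L_V(Q,a_r)=a_r\min\{Q,R_r\}+V\big(Q+(1-a_r)\min\{N_r-Q,R_s\}-a_r\min\{Q,R_r\}\big)$. For every such $(\theta,V)$ and every initial state $X_1\in\mathcal X$, the maximum of the throughput over all unichain policies is attained and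 equals $\theta$; so the optimal throughput does not depend on the initial state. (iii) For every such $(\theta,V)$ and every $\alpha_r^*:\mathcal Q\to\{0,1\}$ with $\alpha_r^*(Q)\in\arg\max_{a_r\in\{0,1\}}L_V(Q,a_r)$ for all $Q$, the policy $(\alpha^*,\mu^*)$ is optimal, where $\alpha^*(Q,G)=G$ if $G\neq(1,1)$ and $\alpha^*(Q,(1,1))=(1-\alpha_r^*(Q),\alpha_r^*(Q))$. -/

import Mathlib

/-- Parameters of the two-hop relaying system: maximum transmission rates `Rs`, `Rr` of the source
and of the relay, relay buffer size `Nr`, and probabilities `ps`, `pr` that the source-relay link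
and the relay-destination link are connected in a slot. -/
structure RelaySystem where
  Rs : ℕ
  Rr : ℕ
  Nr : ℕ
  ps : ℝ
  pr : ℝ

namespace RelaySystem

/-- Standing assumptions: positive maximum rates, a buffer larger than both of them, and link
probabilities in `[0, 1]` for which the connectivity is not degenerate (it is neither the case that
both links are never connected nor that both links are always connected). -/
structure Admissible (S : RelaySystem) : Prop where
  Rs_pos : 0 < S.Rs
  Rr_pos : 0 < S.Rr
  max_lt : max S.Rs S.Rr < S.Nr
  ps_mem : S.ps ∈ Set.Icc (0 : ℝ) 1
  pr_mem : S.pr ∈ Set.Icc (0 : ℝ) 1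
  not_both_zero : ¬ (S.ps = 0 ∧ S.pr = 0)
  not_both_one : ¬ (S.ps = 1 ∧ S.pr = 1)

/-- Queue states `{0, 1, …, Nr}`. -/
abbrev Queue (S : RelaySystem) : Type := Fin (S.Nr + 1)

/-- Joint channel states `(G_s, G_r)`; `1` means connected, `0` not connected. -/
abbrev Channel : Type := Fin 2 × Fin 2

/-- System states `X = (Q, G)`. -/
abbrev State (S : RelaySystem) : Type := S.Queue × Channel

/-- A stationary link selection and transmission rate control policy: `α X = (a_s, a_r)` and
`μ X = (u_s, u_r)`. -/
structure Policy (S : RelaySystem) where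
  α : S.State → Fin 2 × Fin 2
  μ : S.State → ℕ × ℕ
  orthogonal : ∀ X, ((α X).1 : ℕ) + ((α X).2 : ℕ) ≤ 1
  link_00 : ∀ Q, α (Q, (0, 0)) = (0, 0)
  link_01 : ∀ Q, α (Q, (0, 1)) = (0, 1)
  link_10 : ∀ Q, α (Q, (1, 0)) = (1, 0)
  rate_s : ∀ X, (μ X).1 ≤ min S.Rs (S.Nr - (X.1 : ℕ))
  rate_r : ∀ X, (μ X).2 ≤ min S.Rr (X.1 : ℕ)

/-- Probability of a joint channel state: the two links are independent. -/
noncomputable def channelProb (S : RelaySystem) (G : Channel) : ℝ :=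
  (if G.1 = 1 then S.ps else 1 - S.ps) * (if G.2 = 1 then S.pr else 1 - S.pr)

variable {S : RelaySystem}

/-- Queue length after one slot, `Q + a_s u_s - a_r u_r`. -/
def Policy.nextQueue (Ω : S.Policy) (X : S.State) : ℤ :=
  ((X.1 : ℕ) : ℤ) + (((Ω.α X).1 : ℕ) : ℤ) * ((Ω.μ X).1 : ℤ)
    - (((Ω.α X).2 : ℕ) : ℤ) * ((Ω.μ X).2 : ℤ)

/-- Transition matrix of the induced Markov chain on system states: the next channel state is
drawn independently of the past, and the queue follows the queue dynamics. -/
noncomputable def Policy.transition (Ω : S.Policy) : Matrix S.State S.State ℝ :=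
  fun X Y => S.channelProb Y.2 * (if ((Y.1 : ℕ) : ℤ) = Ω.nextQueue X then 1 else 0)

/-- Per-stage reward `a_r u_r`: the number of packets delivered in a slot. -/
def Policy.reward (Ω : S.Policy) (X : S.State) : ℝ :=
  (((Ω.α X).2 : ℕ) : ℝ) * ((Ω.μ X).2 : ℝ)

/-- Expected reward `t` slots after the chain starts in the state `X`. -/
noncomputable def Policy.expectedReward (Ω : S.Policy) (X : S.State) (t : ℕ) : ℝ :=
  ∑ Y, (Ω.transition ^ t) X Y * Ω.reward Y

/-- Average system throughput of the policy from the initial state `X`: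
the limit inferior of the expected rewards averaged over the first `T` slots. -/
noncomputable def Policy.throughput (Ω : S.Policy) (X : S.State) : ℝ :=
  Filter.liminf (fun T : ℕ => (1 / (T : ℝ)) * ∑ t ∈ Finset.range T, Ω.expectedReward X t)
    Filter.atTop

/-- `Y` is accessible from `X` in the induced Markov chain. -/
def Policy.Accessible (Ω : S.Policy) (X Y : S.State) : Prop :=
  ∃ n : ℕ, 0 < (Ω.transition ^ n) X Y

/-- A state of the (finite) chain is recurrent if it is accessible from every state that is
accessible from it. -/
def Policy.Recurrent (Ω : S.Policy) (X : S.State) : Prop :=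
  ∀ Y, Ω.Accessible X Y → Ω.Accessible Y X

/-- A recurrent class is the set of all states that communicate with some recurrent state. -/
def Policy.IsRecurrentClass (Ω : S.Policy) (C : Set S.State) : Prop :=
  ∃ X, Ω.Recurrent X ∧ C = {Y | Ω.Accessible X Y ∧ Ω.Accessible Y X}

/-- A unichain policy: the induced Markov chain has a single recurrent class. -/
def Policy.Unichain (Ω : S.Policy) : Prop :=
  ∃! C : Set S.State, Ω.IsRecurrentClass C

/-- A policy is optimal if it is unichain and, from every initial state, its throughput is the
largest among all unichain policies. -/
def Policy.IsOptimal (Ω : S.Policy) : Prop :=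
  Ω.Unichain ∧ ∀ X, ∀ Ω' : S.Policy, Ω'.Unichain → Ω'.throughput X ≤ Ω.throughput X

/-- The rate control that always sends at full feasible rate. -/
def fullRate (S : RelaySystem) (X : S.State) : ℕ × ℕ :=
  (min S.Rs (S.Nr - (X.1 : ℕ)), min S.Rr (X.1 : ℕ))

/-- The queue state `min {Q + R_s, N_r}`. -/
def fill (Q : S.Queue) : S.Queue :=
  ⟨min ((Q : ℕ) + S.Rs) S.Nr, Nat.lt_succ_of_le (min_le_right _ _)⟩

/-- The queue state `[Q - R_r]⁺` (subtraction of natural numbers truncates at zero). -/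
def drain (Q : S.Queue) : S.Queue :=
  ⟨(Q : ℕ) - S.Rr, lt_of_le_of_lt (Nat.sub_le _ _) Q.isLt⟩

/-- The queue state `Q + (1 - a_r) min {N_r - Q, R_s} - a_r min {Q, R_r}`. -/
def serve (Q : S.Queue) (a : Fin 2) : S.Queue :=
  ⟨(Q : ℕ) + (1 - (a : ℕ)) * min (S.Nr - (Q : ℕ)) S.Rs - (a : ℕ) * min (Q : ℕ) S.Rr, by
    have hQ := Q.isLt
    have h1 : (1 - (a : ℕ)) * min (S.Nr - (Q : ℕ)) S.Rs ≤ S.Nr - (Q : ℕ) :=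
      calc (1 - (a : ℕ)) * min (S.Nr - (Q : ℕ)) S.Rs ≤ 1 * (S.Nr - (Q : ℕ)) :=
            Nat.mul_le_mul (Nat.sub_le _ _) (min_le_left _ _)
        _ = S.Nr - (Q : ℕ) := one_mul _
    omega⟩

/-- The expression maximised over `a_r` when both links are connected:
`a_r min {Q, R_r} + V (Q + (1 - a_r) min {N_r - Q, R_s} - a_r min {Q, R_r})`. -/
def linkValue (V : S.Queue → ℝ) (Q : S.Queue) (a : Fin 2) : ℝ :=
  ((a : ℕ) : ℝ) * ((min (Q : ℕ) S.Rr : ℕ) : ℝ) + V (serve Q a)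

/-- The reduced Bellman equation for `(θ, V)` on the queue states. -/
def SolvesBellman (S : RelaySystem) (θ : ℝ) (V : S.Queue → ℝ) : Prop :=
  ∀ Q : S.Queue,
    θ + V Q = (1 - S.ps) * (1 - S.pr) * V Q
      + S.ps * (1 - S.pr) * V (fill Q)
      + (1 - S.ps) * S.pr * (((min (Q : ℕ) S.Rr : ℕ) : ℝ) + V (drain Q))
      + S.ps * S.pr * max (linkValue V Q 0) (linkValue V Q 1)

/-- `αr Q` is a maximiser over `a_r ∈ {0, 1}` in the reduced Bellman equation, for every `Q`. -/
def IsArgmax (V : S.Queue → ℝ) (αr : S.Queue → Fin 2) : Prop :=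
  ∀ Q a, linkValue V Q a ≤ linkValue V Q (αr Q)

/-- The link selection that is forced unless both links are connected, and is then
`(1 - α_r(Q), α_r(Q))`. -/
def linkSelection (αr : S.Queue → Fin 2) (X : S.State) : Fin 2 × Fin 2 :=
  if X.2 = (1, 1) then (1 - αr X.1, αr X.1) else X.2

/-- The policy with the link selection determined by `αr` and with full feasible rates. -/
def fullRatePolicy (αr : S.Queue → Fin 2) : S.Policy where
  α := linkSelection αr
  μ := S.fullRate
  orthogonal := by
    rintro ⟨Q, g⟩
    simp only [linkSelection]
    generalize αr Q = a
    clear αr Q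
    revert g a
    decide
  link_00 _ := rfl
  link_01 _ := rfl
  link_10 _ := rfl
  rate_s _ := le_rfl
  rate_r _ := le_rfl

end RelaySystem

/-!
# The reduced Bellman equation of the half-duplex relay

The right-hand side of the equation is a monotone operator `T = bellmanOp` on functions of the queue
state that commutes with the addition of constants. Because the link probabilities are not
degenerate, one of the two forced transitions (only the source link connected: fill the buffer; only
the relay link connected: drain it) has positive probability whatever the policy does, and `Nr`
repetitions of it lead from every queue state to one and the same (`exists_collapsing`). This has
three consequences.

* `T^[Nr]`, with the contribution of that common state removed, is a contraction in the supremum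
  norm, so `T V = V + θ` has a solution (`MovesAlong.exists_shift`), and the oscillation of the
  difference of two solutions contracts, so `V` is unique up to an additive constant
  (`MovesAlong.sub_eq_sub`).
* The functions with increments in `[0, 1]` (`UnitSlope`) form a closed class that is invariant under
  `T` and under the addition of constants. It therefore contains one solution, hence every solution
  (`SolvesBellman.unitSlope`). Increments in `[0, 1]` say precisely that filling more never hurts and
  that a delivered packet is worth at least a stored one, so full rates dominate in every state
  (`Policy.reward_add_le`).
* Under full rates that common state can be reached from everywhere, so every full-rate policy is
  unichain (`fullRatePolicy_unichain`).

The function `stageValue V` on the full state space, whose average over the channel is `T V`, is then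
a supersolution of the average reward equation of every policy and a solution of that of a maximising
full-rate policy. Iterating along the chain shows that the total reward of `n` slots is at most
`n θ` plus a constant, and equals `n θ` up to a bounded error for the maximising policy
(`Matrix.liminf_average_le`, `Matrix.tendsto_average`). The upper bound holds for all policies,
unichain or not.
-/

/-! ### Monotone operators with a distinguished path -/

section SpanContraction

variable {ι : Type*} {T : (ι → ℝ) → ι → ℝ} {f : ι → ι} {a : ℝ}

/-- The operator `T` behaves like a Bellman operator in which, whatever the action, the state `x`
moves to `f x` with probability at least `a`: if `V - W ≤ M`, then `T V - T W` at `x` is at most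
the average of `(V - W) (f x)` with weight `a` and of `M` with weight `1 - a`. -/
def MovesAlong (T : (ι → ℝ) → ι → ℝ) (f : ι → ι) (a : ℝ) : Prop :=
  ∀ (V W : ι → ℝ) (M : ℝ), (∀ y, V y - W y ≤ M) →
    ∀ x, T V x - T W x ≤ a * (V (f x) - W (f x)) + (1 - a) * M

theorem MovesAlong.iterate (hT : MovesAlong T f a) (ha0 : 0 ≤ a) (k : ℕ) :
    MovesAlong T^[k] f^[k] (a ^ k) := by
  intro V W M hM
  induction k with
  | zero => intro x; simp
  | succ k ih =>
    intro x
    have hle : ∀ y, T^[k] V y - T^[k] W y ≤ M := fun y => by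
      have h1 := mul_le_mul_of_nonneg_left (hM (f^[k] y)) (pow_nonneg ha0 k)
      linarith [ih y]
    have h1 := hT _ _ M hle x
    have h2 := mul_le_mul_of_nonneg_left (ih (f x)) ha0
    rw [Function.iterate_succ_apply', Function.iterate_succ_apply', Function.iterate_succ_apply]
    calc _ ≤ _ := h1
      _ ≤ _ := add_le_add_left h2 _
      _ = _ := by ring

/-- Operators that move along some map commute with the addition of constants. -/
theorem MovesAlong.map_add_const (hT : MovesAlong T f a) (V : ι → ℝ) (c : ℝ) (x : ι) :
    T (fun y => V y + c) x = T V x + c := by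
  have h1 := hT (fun y => V y + c) V c (fun y => by simp) x
  have h2 := hT V (fun y => V y + c) (-c) (fun y => by simp) x
  simp only [add_sub_cancel_left, sub_add_cancel_left] at h1 h2
  linarith

variable [Finite ι] [Nonempty ι]

/-- If the whole space moves to one point `q` with positive probability, then two functions which
the operator only shifts by a constant differ by a constant: the oscillation of their difference
shrinks by the factor `1 - a` and is unchanged. -/
theorem MovesAlong.sub_eq_sub_of_shift (ha0 : 0 < a) {q : ι} (hT : MovesAlong T (fun _ => q) a)
    {V W : ι → ℝ} {c d : ℝ} (hV : ∀ x, T V x = V x + c)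
    (hW : ∀ x, T W x = W x + d) (x y : ι) : V x - W x = V y - W y := by
  obtain ⟨i, hi⟩ := Finite.exists_max fun z => V z - W z
  obtain ⟨j, hj⟩ := Finite.exists_min fun z => V z - W z
  have h1 := hT V W _ hi i
  have h2 := hT W V (W j - V j) (fun z => by linarith [hj z]) j
  rw [hV, hW] at h1 h2
  have h3 : a * ((V i - W i) - (V j - W j)) ≤ 0 := by linarith
  have h4 : (V i - W i) - (V j - W j) ≤ 0 := nonpos_of_mul_nonpos_right h3 ha0
  linarith [hi x, hi y, hj x, hj y]

/-- Existence of a solution of `T V = V + θ`, inside any closed class of functions that is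
invariant under `T` and under the addition of constants. -/
theorem MovesAlong.exists_shift (hT : MovesAlong T f a) (ha0 : 0 < a) (ha1 : a ≤ 1) {n : ℕ} {q : ι}
    (hf : ∀ x, f^[n] x = q) {K : Set (ι → ℝ)} (hK : IsClosed K) (h0 : (fun _ => 0) ∈ K)
    (hTK : ∀ V ∈ K, T V ∈ K) (hcK : ∀ V ∈ K, ∀ c : ℝ, (fun x => V x + c) ∈ K) :
    ∃ θ : ℝ, ∃ V ∈ K, ∀ x, T V x = V x + θ := by
  have : Fintype ι := Fintype.ofFinite ι
  have hfq : f^[n] = fun _ => q := funext hf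
  have hTn := hT.iterate ha0.le n
  rw [hfq] at hTn
  have hp0 : 0 < a ^ n := pow_pos ha0 n
  have hp1 : a ^ n ≤ 1 := pow_le_one₀ ha0.le ha1
  -- removing the common contribution of the point `q` turns `T^[n]` into a sup-norm contraction
  let A : (ι → ℝ) → ι → ℝ := fun V x => T^[n] V x + -(a ^ n * V q)
  obtain ⟨c, hc⟩ : ∃ c : NNReal, (c : ℝ) = 1 - a ^ n := ⟨⟨1 - a ^ n, by linarith⟩, rfl⟩
  have hA : ContractingWith c A := by
    refine ⟨by rw [← NNReal.coe_lt_coe, hc]; simpa using hp0, LipschitzWith.of_dist_le_mul fun V W => ?_⟩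
    have hd : ∀ y, |V y - W y| ≤ dist V W := fun y => dist_le_pi_dist V W y
    refine (dist_pi_le_iff (mul_nonneg (NNReal.coe_nonneg c) dist_nonneg)).2 fun x => ?_
    have h1 := hTn V W (dist V W) (fun y => (abs_le.1 (hd y)).2) x
    have h2 := hTn W V (dist V W) (fun y => by linarith [(abs_le.1 (hd y)).1]) x
    rw [Real.dist_eq, abs_le]
    simp only [A, hc]
    constructor <;> linarith
  have hTnK : ∀ k, ∀ V ∈ K, T^[k] V ∈ K := fun k => by
    induction k with
    | zero => exact fun V hV => hV
    | succ k ih => exact fun V hV => ih _ (hTK V hV)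
  have hAK : ∀ k, A^[k] (fun _ => 0) ∈ K := fun k => by
    induction k with
    | zero => exact h0
    | succ k ih =>
      rw [Function.iterate_succ_apply']
      exact hcK _ (hTnK n _ ih) _
  set V := hA.fixedPoint with hVdef
  have hVK : V ∈ K :=
    hK.mem_of_tendsto (hA.tendsto_iterate_fixedPoint _) (Filter.Eventually.of_forall hAK)
  have hV : ∀ x, T^[n] V x = V x + a ^ n * V q := fun x => by
    have := congrFun hA.fixedPoint_isFixedPt x
    simp only [A] at this
    linarith
  -- `T V` is another function that `T^[n]` shifts by a constant, so it is `V` up to a constant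
  have hTV : ∀ x, T^[n] (T V) x = T V x + a ^ n * V q := fun x => by
    rw [← Function.iterate_succ_apply, Function.iterate_succ_apply', ← hT.map_add_const V]
    exact congrFun (congrArg T (funext hV)) x
  refine ⟨T V q - V q, V, hVK, fun x => ?_⟩
  linarith [hTn.sub_eq_sub_of_shift hp0 hTV hV x q]

/-- Solutions of `T V = V + θ` are unique up to additive constants. -/
theorem MovesAlong.sub_eq_sub (hT : MovesAlong T f a) (ha0 : 0 < a) {n : ℕ} {q : ι}
    (hf : ∀ x, f^[n] x = q) {V W : ι → ℝ} {c d : ℝ} (hV : ∀ x, T V x = V x + c)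
    (hW : ∀ x, T W x = W x + d) (x y : ι) : V x - W x = V y - W y := by
  have hfq : f^[n] = fun _ => q := funext hf
  have hTn := hT.iterate ha0.le n
  rw [hfq] at hTn
  have key : ∀ (U : ι → ℝ) (e : ℝ), (∀ x, T U x = U x + e) →
      ∀ k x, T^[k] U x = U x + k * e := by
    intro U e hU k
    induction k with
    | zero => intro x; simp
    | succ k ih =>
      intro x
      rw [Function.iterate_succ_apply', show T^[k] U = fun y => U y + k * e from funext ih,
        hT.map_add_const, hU]
      push_cast
      ring
  exact hTn.sub_eq_sub_of_shift (pow_pos ha0 n) (key V c hV n) (key W d hW n) x y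

end SpanContraction

/-! ### Average rewards of a finite Markov chain -/

section AverageReward

open Matrix

variable {ι : Type*} [Fintype ι] [DecidableEq ι] {P : Matrix ι ι ℝ} {r B : ι → ℝ} {θ m : ℝ}

theorem Matrix.sum_pow_mulVec_succ (P : Matrix ι ι ℝ) (r : ι → ℝ) (n : ℕ) (x : ι) :
    ∑ t ∈ Finset.range (n + 1), (P ^ t *ᵥ r) x
      = r x + ∑ y, P x y * ∑ t ∈ Finset.range n, (P ^ t *ᵥ r) y := by
  have h : ∀ t, (P ^ (t + 1) *ᵥ r) x = ∑ y, P x y * (P ^ t *ᵥ r) y := fun t => by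
    rw [pow_succ', ← Matrix.mulVec_mulVec]
    rfl
  rw [Finset.sum_range_succ', add_comm]
  simp only [h, Finset.mul_sum, pow_zero, Matrix.one_mulVec]
  rw [Finset.sum_comm]

/-- A supersolution `B` of the average reward equation bounds the total reward of `n` slots. -/
theorem Matrix.sum_pow_mulVec_le (hP : ∀ x y, 0 ≤ P x y) (hP1 : ∀ x, ∑ y, P x y = 1)
    (hB : ∀ x, r x + ∑ y, P x y * B y ≤ θ + B x) (hm : ∀ x, m ≤ B x) (n : ℕ) (x : ι) :
    ∑ t ∈ Finset.range n, (P ^ t *ᵥ r) x ≤ n * θ + B x - m := by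
  induction n generalizing x with
  | zero => simpa using hm x
  | succ n ih =>
    rw [Matrix.sum_pow_mulVec_succ]
    have h1 : ∑ y, P x y * ∑ t ∈ Finset.range n, (P ^ t *ᵥ r) y
        ≤ ∑ y, P x y * (n * θ + B y - m) :=
      Finset.sum_le_sum fun y _ => mul_le_mul_of_nonneg_left (ih y) (hP x y)
    have h2 : ∑ y, P x y * (n * θ + B y - m) = n * θ - m + ∑ y, P x y * B y := by
      calc _ = ∑ y, (P x y * (n * θ - m) + P x y * B y) :=
            Finset.sum_congr rfl fun y _ => by ring
        _ = _ := by rw [Finset.sum_add_distrib, ← Finset.sum_mul, hP1, one_mul]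
    push_cast
    linarith [hB x]

theorem Matrix.pow_entry_nonneg (hP : ∀ x y, 0 ≤ P x y) (n : ℕ) (x y : ι) : 0 ≤ (P ^ n) x y := by
  induction n generalizing x y with
  | zero =>
    rw [pow_zero, Matrix.one_apply]
    split_ifs <;> norm_num
  | succ n ih =>
    rw [pow_succ, Matrix.mul_apply]
    exact Finset.sum_nonneg fun z _ => mul_nonneg (ih x z) (hP z y)

variable [Nonempty ι]

theorem tendsto_add_const_div_natCast (θ C : ℝ) :
    Filter.Tendsto (fun n : ℕ => θ + C / n) Filter.atTop (nhds θ) := by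
  simpa using tendsto_const_nhds.add (tendsto_const_div_atTop_nhds_zero_nat C)

/-- For a supersolution, the average over `n` slots exceeds `θ` by at most `C / n`. -/
theorem Matrix.average_le (hP : ∀ x y, 0 ≤ P x y) (hP1 : ∀ x, ∑ y, P x y = 1)
    (hB : ∀ x, r x + ∑ y, P x y * B y ≤ θ + B x) (x : ι) :
    ∃ C : ℝ, ∀ n : ℕ, 0 < n →
      (1 / (n : ℝ)) * ∑ t ∈ Finset.range n, (P ^ t *ᵥ r) x ≤ θ + C / n := by
  obtain ⟨j, hj⟩ := Finite.exists_min B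
  refine ⟨B x - B j, fun n hn => ?_⟩
  have hn' : (0 : ℝ) < n := by exact_mod_cast hn
  have h := Matrix.sum_pow_mulVec_le hP hP1 hB hj n x
  rw [one_div_mul_eq_div, div_le_iff₀ hn', add_mul, div_mul_cancel₀ _ hn'.ne']
  linarith

/-- A supersolution of the average reward equation bounds the lower limit of the average reward. -/
theorem Matrix.liminf_average_le (hP : ∀ x y, 0 ≤ P x y) (hP1 : ∀ x, ∑ y, P x y = 1)
    (hr : ∀ x, 0 ≤ r x) (hB : ∀ x, r x + ∑ y, P x y * B y ≤ θ + B x) (x : ι) :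
    Filter.liminf (fun n : ℕ => (1 / (n : ℝ)) * ∑ t ∈ Finset.range n, (P ^ t *ᵥ r) x)
      Filter.atTop ≤ θ := by
  obtain ⟨C, hC⟩ := Matrix.average_le hP hP1 hB x
  have hlim := tendsto_add_const_div_natCast θ C
  rw [← hlim.liminf_eq]
  refine Filter.liminf_le_liminf ?_ ?_ hlim.isCoboundedUnder_ge
  · filter_upwards [Filter.eventually_gt_atTop 0] with n hn using hC n hn
  · refine Filter.isBoundedUnder_of ⟨0, fun n => ?_⟩
    refine mul_nonneg (by positivity) (Finset.sum_nonneg fun t _ => ?_)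
    exact Finset.sum_nonneg fun y _ => mul_nonneg (Matrix.pow_entry_nonneg hP t x y) (hr y)

/-- A solution of the average reward equation determines the average reward. -/
theorem Matrix.tendsto_average (hP : ∀ x y, 0 ≤ P x y) (hP1 : ∀ x, ∑ y, P x y = 1)
    (hB : ∀ x, r x + ∑ y, P x y * B y = θ + B x) (x : ι) :
    Filter.Tendsto (fun n : ℕ => (1 / (n : ℝ)) * ∑ t ∈ Finset.range n, (P ^ t *ᵥ r) x)
      Filter.atTop (nhds θ) := by
  obtain ⟨C, hC⟩ := Matrix.average_le hP hP1 (fun x => (hB x).le) x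
  obtain ⟨D, hD⟩ := Matrix.average_le (r := -r) (B := -B) (θ := -θ) hP hP1 (fun x => by
    have := hB x
    simp only [Pi.neg_apply, mul_neg, Finset.sum_neg_distrib]
    linarith) x
  refine tendsto_of_tendsto_of_tendsto_of_le_of_le' (tendsto_add_const_div_natCast θ (-D))
    (tendsto_add_const_div_natCast θ C) ?_ ?_
  · filter_upwards [Filter.eventually_gt_atTop 0] with n hn
    have := hD n hn
    simp only [Matrix.mulVec_neg, Pi.neg_apply, Finset.sum_neg_distrib, mul_neg] at this
    rw [neg_div]
    linarith
  · filter_upwards [Filter.eventually_gt_atTop 0] with n hn using hC n hn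

end AverageReward

namespace RelaySystem

variable {S : RelaySystem}

/-! ### The reduced Bellman operator -/

/-- The right-hand side of the reduced Bellman equation, as an operator on functions of the
queue state. -/
noncomputable def bellmanOp (S : RelaySystem) (V : S.Queue → ℝ) (Q : S.Queue) : ℝ :=
  (1 - S.ps) * (1 - S.pr) * V Q
    + S.ps * (1 - S.pr) * V (fill Q)
    + (1 - S.ps) * S.pr * (((min (Q : ℕ) S.Rr : ℕ) : ℝ) + V (drain Q))
    + S.ps * S.pr * max (linkValue V Q 0) (linkValue V Q 1)

theorem SolvesBellman.bellmanOp_eq {θ : ℝ} {V : S.Queue → ℝ} (h : S.SolvesBellman θ V)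
    (Q : S.Queue) : S.bellmanOp V Q = V Q + θ := by
  rw [add_comm, h Q, bellmanOp]

theorem linkValue_zero (V : S.Queue → ℝ) (Q : S.Queue) : linkValue V Q 0 = V (fill Q) := by
  have : serve Q 0 = fill Q := by
    ext
    have := Q.isLt
    simp only [serve, fill, Fin.val_zero]
    omega
  simp [linkValue, this]

theorem linkValue_one (V : S.Queue → ℝ) (Q : S.Queue) :
    linkValue V Q 1 = ((min (Q : ℕ) S.Rr : ℕ) : ℝ) + V (drain Q) := by
  have : serve Q 1 = drain Q := by
    ext
    simp only [serve, drain, Fin.val_one]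
    omega
  simp [linkValue, this]

theorem bellmanOp_sub_le (hS : S.Admissible) {V W : S.Queue → ℝ} {M : ℝ}
    (hM : ∀ q, V q - W q ≤ M) (Q : S.Queue) :
    S.bellmanOp V Q - S.bellmanOp W Q ≤
      (1 - S.ps) * (1 - S.pr) * M + S.ps * (1 - S.pr) * (V (fill Q) - W (fill Q))
        + (1 - S.ps) * S.pr * (V (drain Q) - W (drain Q)) + S.ps * S.pr * M := by
  have h0 : 0 ≤ (1 - S.ps) * (1 - S.pr) :=
    mul_nonneg (sub_nonneg.2 hS.ps_mem.2) (sub_nonneg.2 hS.pr_mem.2)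
  have h1 : 0 ≤ S.ps * S.pr := mul_nonneg hS.ps_mem.1 hS.pr_mem.1
  have hmax : max (linkValue V Q 0) (linkValue V Q 1)
      ≤ max (linkValue W Q 0) (linkValue W Q 1) + M := by
    simp only [linkValue_zero, linkValue_one]
    refine max_le ?_ ?_
    · linarith [hM (fill Q), le_max_left (W (fill Q))
        (((min (Q : ℕ) S.Rr : ℕ) : ℝ) + W (drain Q))]
    · linarith [hM (drain Q), le_max_right (W (fill Q))
        (((min (Q : ℕ) S.Rr : ℕ) : ℝ) + W (drain Q))]
  have h2 := mul_le_mul_of_nonneg_left (hM Q) h0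
  have h3 := mul_le_mul_of_nonneg_left hmax h1
  unfold bellmanOp
  linarith

theorem movesAlong_fill (hS : S.Admissible) :
    MovesAlong S.bellmanOp fill (S.ps * (1 - S.pr)) := by
  intro V W M hM Q
  have h0 : 0 ≤ (1 - S.ps) * S.pr := mul_nonneg (sub_nonneg.2 hS.ps_mem.2) hS.pr_mem.1
  have h1 := mul_le_mul_of_nonneg_left (hM (drain Q)) h0
  linarith [bellmanOp_sub_le hS hM Q]

theorem movesAlong_drain (hS : S.Admissible) :
    MovesAlong S.bellmanOp drain ((1 - S.ps) * S.pr) := by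
  intro V W M hM Q
  have h0 : 0 ≤ S.ps * (1 - S.pr) := mul_nonneg hS.ps_mem.1 (sub_nonneg.2 hS.pr_mem.2)
  have h1 := mul_le_mul_of_nonneg_left (hM (fill Q)) h0
  linarith [bellmanOp_sub_le hS hM Q]

theorem iterate_fill (hS : S.Admissible) (Q : S.Queue) : fill^[S.Nr] Q = Fin.last S.Nr := by
  have key : ∀ k, ((fill^[k] Q : S.Queue) : ℕ) = min ((Q : ℕ) + k * S.Rs) S.Nr := fun k => by
    induction k with
    | zero => simpa using Nat.le_of_lt_succ Q.isLt
    | succ k ih =>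
      rw [Function.iterate_succ_apply', fill]
      simp only [ih, Nat.succ_mul]
      omega
  ext
  have h : S.Nr * 1 ≤ S.Nr * S.Rs := Nat.mul_le_mul_left _ hS.Rs_pos
  rw [key, Fin.val_last]
  omega

theorem iterate_drain (hS : S.Admissible) (Q : S.Queue) : drain^[S.Nr] Q = 0 := by
  have key : ∀ k, ((drain^[k] Q : S.Queue) : ℕ) = (Q : ℕ) - k * S.Rr := fun k => by
    induction k with
    | zero => simp
    | succ k ih =>
      rw [Function.iterate_succ_apply', drain]
      simp only [ih, Nat.succ_mul]
      omega
  ext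
  have h : S.Nr * 1 ≤ S.Nr * S.Rr := Nat.mul_le_mul_left _ hS.Rr_pos
  have := Q.isLt
  rw [key, Fin.val_zero]
  omega

/-- Nondegeneracy makes one of the two forced transitions, filling or draining the buffer, occur
with positive probability; repeated, it leads to a single queue state. The channel state `G` that
forces the transition is part of the data. -/
theorem exists_collapsing (hS : S.Admissible) :
    ∃ (G : Channel) (f : S.Queue → S.Queue) (q : S.Queue),
      ((G = (1, 0) ∧ f = fill) ∨ (G = (0, 1) ∧ f = drain)) ∧ 0 < S.channelProb G ∧
      S.channelProb G ≤ 1 ∧ (∀ Q, f^[S.Nr] Q = q) ∧ MovesAlong S.bellmanOp f (S.channelProb G) := by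
  obtain ⟨hs0, hs1⟩ := hS.ps_mem
  obtain ⟨hr0, hr1⟩ := hS.pr_mem
  have h10 : S.channelProb (1, 0) = S.ps * (1 - S.pr) := by simp [channelProb]
  have h01 : S.channelProb (0, 1) = (1 - S.ps) * S.pr := by simp [channelProb]
  by_cases h : 0 < S.ps * (1 - S.pr)
  · refine ⟨(1, 0), fill, Fin.last _, Or.inl ⟨rfl, rfl⟩, ?_, ?_, iterate_fill hS, ?_⟩ <;> rw [h10]
    · exact h
    · nlinarith
    · exact movesAlong_fill hS
  · have h' : 0 < (1 - S.ps) * S.pr := by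
      have hz : S.ps * (1 - S.pr) = 0 :=
        le_antisymm (not_lt.1 h) (mul_nonneg hs0 (sub_nonneg.2 hr1))
      rcases mul_eq_zero.1 hz with hp | hp
      · have : S.pr ≠ 0 := fun h0 => hS.not_both_zero ⟨hp, h0⟩
        rw [hp, sub_zero, one_mul]
        exact lt_of_le_of_ne hr0 this.symm
      · have hp1 : S.pr = 1 := by linarith
        have : S.ps ≠ 1 := fun h1 => hS.not_both_one ⟨h1, hp1⟩
        rw [hp1, mul_one, sub_pos]
        exact lt_of_le_of_ne hs1 this
    refine ⟨(0, 1), drain, 0, Or.inr ⟨rfl, rfl⟩, ?_, ?_, iterate_drain hS, ?_⟩ <;> rw [h01]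
    · exact h'
    · nlinarith
    · exact movesAlong_drain hS

/-! ### Monotonicity and unit slope of the value function -/

/-- The functions of the queue state with increments between `0` and `1` per packet. For these,
sending at full feasible rate is never worse than sending less. -/
def UnitSlope (S : RelaySystem) : Set (S.Queue → ℝ) :=
  {V | ∀ p q : S.Queue, p ≤ q → V p ≤ V q ∧ V q ≤ V p + (((q : ℕ) : ℝ) - ((p : ℕ) : ℝ))}

theorem isClosed_unitSlope : IsClosed S.UnitSlope := by
  simp only [UnitSlope, Set.ofPred_forall]
  refine isClosed_iInter fun p => isClosed_iInter fun q => isClosed_iInter fun _ => ?_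
  exact (isClosed_le (continuous_apply p) (continuous_apply q)).inter
    (isClosed_le (continuous_apply q) ((continuous_apply p).add continuous_const))

theorem UnitSlope.add_const {V : S.Queue → ℝ} (hV : V ∈ S.UnitSlope) (c : ℝ) :
    (fun Q => V Q + c) ∈ S.UnitSlope := fun p q hpq => by
  obtain ⟨h1, h2⟩ := hV p q hpq
  constructor <;> linarith

theorem UnitSlope.comp_fill {V : S.Queue → ℝ} (hV : V ∈ S.UnitSlope) :
    (fun Q : S.Queue => V (fill Q)) ∈ S.UnitSlope := fun p q hpq => by
  have hpq' : (p : ℕ) ≤ q := hpq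
  obtain ⟨h1, h2⟩ := hV (fill p) (fill q) (by
    rw [Fin.le_def]
    simp only [fill]
    omega)
  have h3 : ((fill q : S.Queue) : ℕ) + (p : ℕ) ≤ (fill p : S.Queue) + (q : ℕ) := by
    simp only [fill]
    omega
  have h4 : (((fill q : S.Queue) : ℕ) : ℝ) + ((p : ℕ) : ℝ)
      ≤ ((fill p : S.Queue) : ℕ) + ((q : ℕ) : ℝ) := by exact_mod_cast h3
  exact ⟨h1, by linarith⟩

theorem UnitSlope.comp_drain {V : S.Queue → ℝ} (hV : V ∈ S.UnitSlope) :
    (fun Q : S.Queue => ((min (Q : ℕ) S.Rr : ℕ) : ℝ) + V (drain Q)) ∈ S.UnitSlope := fun p q hpq => by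
  have hpq' : (p : ℕ) ≤ q := hpq
  obtain ⟨h1, h2⟩ := hV (drain p) (drain q) (by
    rw [Fin.le_def]
    simp only [drain]
    omega)
  have h3 : ∀ x : S.Queue, ((min (x : ℕ) S.Rr : ℕ) : ℝ) + ((drain x : S.Queue) : ℕ)
      = ((x : ℕ) : ℝ) := fun x => by
    have : min (x : ℕ) S.Rr + (drain x : S.Queue) = (x : ℕ) := by
      simp only [drain]
      omega
    exact_mod_cast this
  have h4 : ((min (p : ℕ) S.Rr : ℕ) : ℝ) ≤ ((min (q : ℕ) S.Rr : ℕ) : ℝ) := by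
    exact_mod_cast min_le_min_right _ hpq'
  have := h3 p
  have := h3 q
  constructor <;> linarith

theorem UnitSlope.bellmanOp (hS : S.Admissible) {V : S.Queue → ℝ} (hV : V ∈ S.UnitSlope) :
    S.bellmanOp V ∈ S.UnitSlope := fun p q hpq => by
  obtain ⟨hs0, hs1⟩ := hS.ps_mem
  obtain ⟨hr0, hr1⟩ := hS.pr_mem
  have h00 : 0 ≤ (1 - S.ps) * (1 - S.pr) := mul_nonneg (sub_nonneg.2 hs1) (sub_nonneg.2 hr1)
  have h10 : 0 ≤ S.ps * (1 - S.pr) := mul_nonneg hs0 (sub_nonneg.2 hr1)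
  have h01 : 0 ≤ (1 - S.ps) * S.pr := mul_nonneg (sub_nonneg.2 hs1) hr0
  have h11 : 0 ≤ S.ps * S.pr := mul_nonneg hs0 hr0
  obtain ⟨a1, a2⟩ := hV p q hpq
  obtain ⟨b1, b2⟩ := UnitSlope.comp_fill hV p q hpq
  obtain ⟨c1, c2⟩ := UnitSlope.comp_drain hV p q hpq
  have d1 := max_le_max b1 c1
  have d2 := max_le_max b2 c2
  rw [max_add_add_right] at d2
  simp only [RelaySystem.bellmanOp, linkValue_zero, linkValue_one]
  constructor
  · linarith [mul_le_mul_of_nonneg_left a1 h00, mul_le_mul_of_nonneg_left b1 h10,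
      mul_le_mul_of_nonneg_left c1 h01, mul_le_mul_of_nonneg_left d1 h11]
  · linarith [mul_le_mul_of_nonneg_left a2 h00, mul_le_mul_of_nonneg_left b2 h10,
      mul_le_mul_of_nonneg_left c2 h01, mul_le_mul_of_nonneg_left d2 h11]

theorem exists_solvesBellman_unitSlope (hS : S.Admissible) :
    ∃ (θ : ℝ) (V : S.Queue → ℝ), V ∈ S.UnitSlope ∧ S.SolvesBellman θ V := by
  obtain ⟨G, f, q, -, hG0, hG1, hf, hT⟩ := exists_collapsing hS
  obtain ⟨θ, V, hV, h⟩ := hT.exists_shift hG0 hG1 hf isClosed_unitSlope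
    (fun p q hpq => by simpa using hpq) (fun V => UnitSlope.bellmanOp hS)
    (fun V => UnitSlope.add_const)
  exact ⟨θ, V, hV, fun Q => by rw [add_comm, ← h Q, bellmanOp]⟩

/-- Every solution has unit slope, because it differs by a constant from the one that does. -/
theorem SolvesBellman.unitSlope (hS : S.Admissible) {θ : ℝ} {V : S.Queue → ℝ}
    (h : S.SolvesBellman θ V) : V ∈ S.UnitSlope := by
  obtain ⟨G, f, q, -, hG0, -, hf, hT⟩ := exists_collapsing hS
  obtain ⟨θ', W, hW, h'⟩ := exists_solvesBellman_unitSlope hS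
  have key := hT.sub_eq_sub hG0 hf h.bellmanOp_eq h'.bellmanOp_eq
  rw [show V = fun Q => W Q + (V q - W q) from funext fun Q => by linarith [key Q q]]
  exact UnitSlope.add_const hW _

/-! ### The induced Markov chain -/

theorem channelProb_nonneg (hS : S.Admissible) (G : Channel) : 0 ≤ S.channelProb G := by
  obtain ⟨hs0, hs1⟩ := hS.ps_mem
  obtain ⟨hr0, hr1⟩ := hS.pr_mem
  unfold channelProb
  refine mul_nonneg ?_ ?_ <;> split_ifs <;> linarith

theorem sum_channelProb (S : RelaySystem) : ∑ G, S.channelProb G = 1 := by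
  simp only [channelProb, Fintype.sum_prod_type, Fin.sum_univ_two]
  norm_num
  ring

namespace Policy

/-- The queue length after one slot stays within the buffer. -/
theorem nextQueue_mem (Ω : S.Policy) (X : S.State) :
    0 ≤ Ω.nextQueue X ∧ Ω.nextQueue X ≤ S.Nr := by
  have hs := Ω.rate_s X
  have hr := Ω.rate_r X
  have hQ := X.1.isLt
  unfold nextQueue
  generalize Ω.α X = a
  obtain ⟨⟨a, ha⟩, ⟨b, hb⟩⟩ := a
  interval_cases a <;> interval_cases b <;> push_cast <;> omega

/-- The queue state after one slot. -/
def next (Ω : S.Policy) (X : S.State) : S.Queue :=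
  ⟨(Ω.nextQueue X).toNat, by have := Ω.nextQueue_mem X; omega⟩

theorem next_eq_iff (Ω : S.Policy) (X : S.State) (q : S.Queue) :
    ((q : ℕ) : ℤ) = Ω.nextQueue X ↔ q = Ω.next X := by
  have := Ω.nextQueue_mem X
  rw [Fin.ext_iff, next]
  simp only
  omega

theorem transition_apply (Ω : S.Policy) (X Y : S.State) :
    Ω.transition X Y = S.channelProb Y.2 * if Y.1 = Ω.next X then 1 else 0 := by
  simp only [transition, next_eq_iff]

theorem transition_nonneg (hS : S.Admissible) (Ω : S.Policy) (X Y : S.State) :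
    0 ≤ Ω.transition X Y := by
  rw [transition_apply]
  exact mul_nonneg (channelProb_nonneg hS _) (by split_ifs <;> norm_num)

theorem sum_transition_mul (Ω : S.Policy) (X : S.State) (h : S.State → ℝ) :
    ∑ Y, Ω.transition X Y * h Y = ∑ G, S.channelProb G * h (Ω.next X, G) := by
  rw [Fintype.sum_prod_type, Finset.sum_comm]
  refine Finset.sum_congr rfl fun G _ => ?_
  simp [transition_apply]

theorem sum_transition (Ω : S.Policy) (X : S.State) : ∑ Y, Ω.transition X Y = 1 := by
  simpa [sum_channelProb] using Ω.sum_transition_mul X fun _ => 1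

theorem reward_nonneg (Ω : S.Policy) (X : S.State) : 0 ≤ Ω.reward X := by
  unfold reward
  positivity

theorem accessible_trans (hS : S.Admissible) {Ω : S.Policy} {X Y Z : S.State}
    (h1 : Ω.Accessible X Y) (h2 : Ω.Accessible Y Z) : Ω.Accessible X Z := by
  obtain ⟨m, hm⟩ := h1
  obtain ⟨n, hn⟩ := h2
  refine ⟨m + n, ?_⟩
  have hP := Matrix.pow_entry_nonneg (Ω.transition_nonneg hS)
  rw [pow_add, Matrix.mul_apply]
  exact lt_of_lt_of_le (mul_pos hm hn) (Finset.single_le_sum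
    (f := fun W => (Ω.transition ^ m) X W * (Ω.transition ^ n) W Z)
    (fun W _ => mul_nonneg (hP m X W) (hP n W Z)) (Finset.mem_univ Y))

theorem accessible_next (Ω : S.Policy) (X : S.State) {G : Channel} (hG : 0 < S.channelProb G) :
    Ω.Accessible X (Ω.next X, G) :=
  ⟨1, by simpa [transition_apply] using hG⟩

/-- A state that is accessible from everywhere lies in the only recurrent class. -/
theorem unichain_of_accessible (hS : S.Admissible) {Ω : S.Policy} {X : S.State}
    (h : ∀ Y, Ω.Accessible Y X) : Ω.Unichain := by
  refine ⟨_, ⟨X, fun Y _ => h Y, rfl⟩, ?_⟩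
  rintro C ⟨Y, hY, rfl⟩
  have hYX := h Y
  have hXY := hY X hYX
  ext Z
  exact ⟨fun hZ => ⟨accessible_trans hS hXY hZ.1, h Z⟩,
    fun hZ => ⟨accessible_trans hS hYX hZ.1, accessible_trans hS hZ.2 hXY⟩⟩

end Policy

/-! ### Optimality of full rates -/

/-- The best reward of the current slot plus the value of the next queue state, at full rates. -/
noncomputable def stageValue (V : S.Queue → ℝ) (X : S.State) : ℝ :=
  if X.2.1 = 1 then
    if X.2.2 = 1 then max (linkValue V X.1 0) (linkValue V X.1 1) else V (fill X.1)
  else if X.2.2 = 1 then ((min (X.1 : ℕ) S.Rr : ℕ) : ℝ) + V (drain X.1) else V X.1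

/-- Averaging the stage value over the channel gives the right-hand side of the reduced Bellman
equation. -/
theorem sum_channelProb_mul_stageValue (V : S.Queue → ℝ) (Q : S.Queue) :
    ∑ G, S.channelProb G * stageValue V (Q, G) = S.bellmanOp V Q := by
  simp only [channelProb, stageValue, Fintype.sum_prod_type, Fin.sum_univ_two, bellmanOp]
  norm_num
  ring

theorem SolvesBellman.sum_transition_mul_stageValue {θ : ℝ} {V : S.Queue → ℝ}
    (h : S.SolvesBellman θ V) (Ω : S.Policy) (X : S.State) :
    ∑ Y, Ω.transition X Y * stageValue V Y = V (Ω.next X) + θ := by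
  rw [Ω.sum_transition_mul, sum_channelProb_mul_stageValue, h.bellmanOp_eq]

/-- A link selection is forced unless both links are connected. -/
theorem Policy.α_cases (Ω : S.Policy) (Q : S.Queue) (G : Channel) :
    (G = (0, 0) ∧ Ω.α (Q, G) = (0, 0)) ∨ (G = (0, 1) ∧ Ω.α (Q, G) = (0, 1)) ∨
    (G = (1, 0) ∧ Ω.α (Q, G) = (1, 0)) ∨
    (G = (1, 1) ∧ (Ω.α (Q, G) = (0, 0) ∨ Ω.α (Q, G) = (0, 1) ∨ Ω.α (Q, G) = (1, 0))) := by
  have h := Ω.orthogonal (Q, G)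
  have h00 := Ω.link_00 Q
  have h01 := Ω.link_01 Q
  have h10 := Ω.link_10 Q
  have key : ∀ a : Fin 2 × Fin 2, ((a.1 : ℕ) + (a.2 : ℕ) ≤ 1) →
      a = (0, 0) ∨ a = (0, 1) ∨ a = (1, 0) := by decide
  have hG : ∀ g : Fin 2 × Fin 2, g = (0, 0) ∨ g = (0, 1) ∨ g = (1, 0) ∨ g = (1, 1) := by decide
  rcases hG G with rfl | rfl | rfl | rfl
  · exact Or.inl ⟨rfl, h00⟩
  · exact Or.inr (Or.inl ⟨rfl, h01⟩)
  · exact Or.inr (Or.inr (Or.inl ⟨rfl, h10⟩))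
  · exact Or.inr (Or.inr (Or.inr ⟨rfl, key _ h⟩))

/-- The action of a policy in one state is worth at most the action at full rates. -/
theorem Policy.reward_add_le (Ω : S.Policy) {V : S.Queue → ℝ} (hV : V ∈ S.UnitSlope)
    (X : S.State) : Ω.reward X + V (Ω.next X) ≤ stageValue V X := by
  obtain ⟨Q, G⟩ := X
  have hs := Ω.rate_s (Q, G)
  have hr := Ω.rate_r (Q, G)
  have hQ := Q.isLt
  have hn : (((Ω.next (Q, G) : S.Queue) : ℕ) : ℤ) = Ω.nextQueue (Q, G) :=
    (Ω.next_eq_iff _ _).2 rfl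
  simp only [nextQueue] at hn
  have hidle : Ω.α (Q, G) = (0, 0) → Ω.reward (Q, G) + V (Ω.next (Q, G)) = V Q := fun h => by
    have : Ω.next (Q, G) = Q := by
      ext
      simp only [h, Fin.val_zero] at hn
      omega
    simp [reward, h, this]
  have hfill : Ω.α (Q, G) = (1, 0) → Ω.reward (Q, G) + V (Ω.next (Q, G)) ≤ V (fill Q) :=
    fun h => by
    have : Ω.next (Q, G) ≤ fill Q := by
      rw [Fin.le_def]
      simp only [h, Fin.val_zero, Fin.val_one, fill] at hn ⊢
      omega
    simpa [reward, h] using (hV _ _ this).1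
  have hdrain : Ω.α (Q, G) = (0, 1) →
      Ω.reward (Q, G) + V (Ω.next (Q, G)) ≤ ((min (Q : ℕ) S.Rr : ℕ) : ℝ) + V (drain Q) :=
    fun h => by
    have h1 : drain Q ≤ Ω.next (Q, G) := by
      rw [Fin.le_def]
      simp only [h, Fin.val_zero, Fin.val_one, drain] at hn ⊢
      omega
    have h2 : (Ω.μ (Q, G)).2 + ((Ω.next (Q, G) : S.Queue) : ℕ)
        = min (Q : ℕ) S.Rr + (drain Q : S.Queue) := by
      simp only [h, Fin.val_zero, Fin.val_one, drain] at hn ⊢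
      omega
    have h3 : ((Ω.μ (Q, G)).2 : ℝ) + (((Ω.next (Q, G) : S.Queue) : ℕ) : ℝ)
        = ((min (Q : ℕ) S.Rr : ℕ) : ℝ) + (((drain Q : S.Queue) : ℕ) : ℝ) := by exact_mod_cast h2
    have h4 := (hV _ _ h1).2
    simp only [reward, h, Fin.val_one, Nat.cast_one, one_mul]
    linarith
  have hle : V Q ≤ V (fill Q) := (hV Q (fill Q) (by
    rw [Fin.le_def]
    simp only [fill]
    omega)).1
  rcases Ω.α_cases Q G with ⟨rfl, h⟩ | ⟨rfl, h⟩ | ⟨rfl, h⟩ | ⟨rfl, h⟩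
  · simpa [stageValue] using (hidle h).le
  · simpa [stageValue] using hdrain h
  · simpa [stageValue] using hfill h
  · simp only [stageValue, if_true, linkValue_zero, linkValue_one]
    rcases h with h | h | h
    · exact le_max_of_le_left ((hidle h).le.trans hle)
    · exact le_max_of_le_right (hdrain h)
    · exact le_max_of_le_left (hfill h)

theorem fullRatePolicy_next_fill (αr : S.Queue → Fin 2) (X : S.State)
    (h : linkSelection αr X = (1, 0)) : (fullRatePolicy αr).next X = fill X.1 := by
  refine (((fullRatePolicy αr).next_eq_iff X _).1 ?_).symm
  have := X.1.isLt
  simp only [Policy.nextQueue, fullRatePolicy, h, fullRate, fill, Fin.val_zero, Fin.val_one]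
  omega

theorem fullRatePolicy_next_drain (αr : S.Queue → Fin 2) (X : S.State)
    (h : linkSelection αr X = (0, 1)) : (fullRatePolicy αr).next X = drain X.1 := by
  refine (((fullRatePolicy αr).next_eq_iff X _).1 ?_).symm
  have := X.1.isLt
  simp only [Policy.nextQueue, fullRatePolicy, h, fullRate, drain, Fin.val_zero, Fin.val_one]
  omega

/-- With a maximising link selection the stage value is attained. -/
theorem fullRatePolicy_reward_add {V : S.Queue → ℝ} {αr : S.Queue → Fin 2} (h : IsArgmax V αr)
    (X : S.State) :
    (fullRatePolicy αr).reward X + V ((fullRatePolicy αr).next X) = stageValue V X := by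
  obtain ⟨Q, G⟩ := X
  have hfill : linkSelection αr (Q, G) = (1, 0) →
      (fullRatePolicy αr).reward (Q, G) + V ((fullRatePolicy αr).next (Q, G)) = V (fill Q) :=
    fun hl => by
    rw [fullRatePolicy_next_fill αr _ hl]
    simp [Policy.reward, fullRatePolicy, hl]
  have hdrain : linkSelection αr (Q, G) = (0, 1) →
      (fullRatePolicy αr).reward (Q, G) + V ((fullRatePolicy αr).next (Q, G))
        = ((min (Q : ℕ) S.Rr : ℕ) : ℝ) + V (drain Q) :=
    fun hl => by
    rw [fullRatePolicy_next_drain αr _ hl]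
    simp [Policy.reward, fullRatePolicy, hl, fullRate, min_comm]
  rcases (fullRatePolicy αr).α_cases Q G with ⟨rfl, hl⟩ | ⟨rfl, hl⟩ | ⟨rfl, hl⟩ | ⟨rfl, -⟩
  · have hn : (fullRatePolicy αr).next (Q, (0, 0)) = Q := by
      refine (((fullRatePolicy αr).next_eq_iff _ _).1 ?_).symm
      simp [Policy.nextQueue, hl]
    rw [hn]
    simp [Policy.reward, hl, stageValue]
  · simpa [stageValue] using hdrain hl
  · simpa [stageValue] using hfill hl
  · have h0 := h Q 0
    have h1 := h Q 1
    simp only [stageValue, if_true]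
    have ha : αr Q = 0 ∨ αr Q = 1 := by
      generalize αr Q = a
      revert a
      decide
    rcases ha with ha | ha <;> rw [ha] at h0 h1
    · rw [max_eq_left h1, linkValue_zero]
      exact hfill (by simp [linkSelection, ha])
    · rw [max_eq_right h0, linkValue_one]
      exact hdrain (by simp [linkSelection, ha])

/-- Under full rates the collapsing transition is available in every queue state, so that the
state it leads to is accessible from everywhere. -/
theorem fullRatePolicy_unichain (hS : S.Admissible) (αr : S.Queue → Fin 2) :
    (fullRatePolicy αr).Unichain := by
  obtain ⟨G, f, q, hGf, hG, -, hf, -⟩ := exists_collapsing hS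
  have hnext : ∀ Q, (fullRatePolicy αr).next (Q, G) = f Q := fun Q => by
    rcases hGf with ⟨rfl, rfl⟩ | ⟨rfl, rfl⟩
    · exact fullRatePolicy_next_fill αr _ (by simp [linkSelection])
    · exact fullRatePolicy_next_drain αr _ (by simp [linkSelection])
  have hacc : ∀ k Q, (fullRatePolicy αr).Accessible (Q, G) (f^[k] Q, G) := fun k => by
    induction k with
    | zero => exact fun Q => ⟨0, by simp⟩
    | succ k ih =>
      intro Q
      have h1 := (fullRatePolicy αr).accessible_next (Q, G) hG
      rw [hnext] at h1
      exact Policy.accessible_trans hS h1 (ih (f Q))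
  refine Policy.unichain_of_accessible hS (X := (q, G)) fun Y => ?_
  have h2 := hacc S.Nr ((fullRatePolicy αr).next Y)
  rw [hf] at h2
  exact Policy.accessible_trans hS ((fullRatePolicy αr).accessible_next Y hG) h2

/-- The upper bound of the verification argument; unichain policies are not singled out. -/
theorem SolvesBellman.throughput_le (hS : S.Admissible) {θ : ℝ} {V : S.Queue → ℝ}
    (h : S.SolvesBellman θ V) (Ω : S.Policy) (X : S.State) : Ω.throughput X ≤ θ := by
  refine Matrix.liminf_average_le (B := stageValue V) (Ω.transition_nonneg hS) Ω.sum_transition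
    Ω.reward_nonneg (fun Y => ?_) X
  rw [h.sum_transition_mul_stageValue]
  linarith [Ω.reward_add_le (h.unitSlope hS) Y]

theorem SolvesBellman.throughput_fullRatePolicy (hS : S.Admissible) {θ : ℝ} {V : S.Queue → ℝ}
    (h : S.SolvesBellman θ V) {αr : S.Queue → Fin 2} (hα : IsArgmax V αr) (X : S.State) :
    (fullRatePolicy αr).throughput X = θ := by
  refine (Matrix.tendsto_average (B := stageValue V) ((fullRatePolicy αr).transition_nonneg hS)
    (fullRatePolicy αr).sum_transition (fun Y => ?_) X).liminf_eq
  rw [h.sum_transition_mul_stageValue]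
  linarith [fullRatePolicy_reward_add hα Y]

theorem SolvesBellman.isOptimal (hS : S.Admissible) {θ : ℝ} {V : S.Queue → ℝ}
    (h : S.SolvesBellman θ V) {αr : S.Queue → Fin 2} (hα : IsArgmax V αr) :
    (fullRatePolicy αr).IsOptimal :=
  ⟨fullRatePolicy_unichain hS αr, fun X Ω _ =>
    (h.throughput_le hS Ω X).trans_eq (h.throughput_fullRatePolicy hS hα X).symm⟩

theorem exists_isArgmax (V : S.Queue → ℝ) : ∃ αr : S.Queue → Fin 2, IsArgmax V αr := by
  choose αr h using fun Q => Finite.exists_max (linkValue V Q)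
  exact ⟨αr, h⟩

end RelaySystem

theorem theorem1 (S : RelaySystem) (hS : S.Admissible) :
    -- (i) sending at full feasible rate is an optimal rate control
    (∃ Ω : S.Policy, Ω.IsOptimal ∧ ∀ X, Ω.μ X = S.fullRate X) ∧
    -- (ii) the reduced Bellman equation has a solution, and for every solution `(θ, V)` the
    -- constant `θ` is the maximal throughput over the unichain policies, from every initial state
    (∃ (θ : ℝ) (V : S.Queue → ℝ), S.SolvesBellman θ V) ∧
    (∀ (θ : ℝ) (V : S.Queue → ℝ), S.SolvesBellman θ V →
      (∀ X : S.State,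
        IsGreatest {r : ℝ | ∃ Ω : S.Policy, Ω.Unichain ∧ Ω.throughput X = r} θ) ∧
      -- (iii) every link selection that is forced unless both links are connected, and is then a
      -- maximiser in the equation, is optimal together with the full feasible rates
      ∀ αr : S.Queue → Fin 2, RelaySystem.IsArgmax V αr →
        (RelaySystem.fullRatePolicy αr).IsOptimal) := by
  obtain ⟨θ, V, -, h⟩ := RelaySystem.exists_solvesBellman_unitSlope hS
  obtain ⟨αr, hα⟩ := RelaySystem.exists_isArgmax V
  refine ⟨⟨RelaySystem.fullRatePolicy αr, h.isOptimal hS hα, fun _ => rfl⟩, ⟨θ, V, h⟩,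
    fun θ' W h' => ⟨fun X => ⟨?_, ?_⟩, fun βr hβ => h'.isOptimal hS hβ⟩⟩
  · obtain ⟨βr, hβ⟩ := RelaySystem.exists_isArgmax W
    exact ⟨_, RelaySystem.fullRatePolicy_unichain hS βr, h'.throughput_fullRatePolicy hS hβ X⟩
  · rintro r ⟨Ω, -, rfl⟩
    exact h'.throughput_le hS Ω X
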